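/- Let $n\ge 2$, let $S^{n-1}=\{x\in\mathbb{R}^n:\|x\|=1\}$, where $\|\cdot\|$ is the Euclidean norm, and let $\mathrm{Lip}(S^{n-1})$ be the set of Lipschitz functions $u:S^{n-1}\to\mathbb{R}$. For $u\in\mathrm{Lip}(S^{n-1})$, let $\nabla u(x)\in T_xS^{n-1}$ denote the spherical gradient of $u$, which exists for $H^{n-1}$-almost every $x\in S^{n-1}$, where $H^{n-1}$ is the $(n-1)$-dimensional Hausdorff measure. A sequence $(u_i)$ in $\mathrm{Lip}(S^{n-1})$ is said to $\tau$-converge to $u\in\mathrm{Lip}(S^{n-1})$ if 1. $u_i\to u$ uniformly on $S^{n-1}$; 2. $\nabla u_i(x)\to\nabla u(x)$ for $H^{n-1}$-almost every $x\in S^{n-1}$; 3. there is a constant $C>0$ such that, for every $i$, $\|\nabla u_i(x)\|\le C$ for $H^{n-1}$-almost every $x\in S^{n-1}$. Let $\tau$ be the topology on $\mathrm{Lip}(S^{n-1})$ induced by this convergence: a set $U$ is open if and only if every sequence that $\tau$-converges to a point of $U$ is eventually in $U$. A valuation on $\mathrm{Lip}(S^{n-1})$ is a function $\mu:\mathrm{Lip}(S^{n-1})\to\mathbb{R}$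 such that $$\mu(u\vee v)+\mu(u\wedge v)=\mu(u)+\mu(v)\qquad\text{for all }u,v\in\mathrm{Lip}(S^{n-1}),$$ where $\vee$ and $\wedge$ are the pointwise maximum and minimum. Finally, let $\mathcal{H}(S^{n-1})\subseteq\mathrm{Lip}(S^{n-1})$ be the set of restrictions to $S^{n-1}$ of the support functions $h_K(x)=\max_{y\in K}\langle x,y\rangle$ of non-empty compact convex sets $K\subset\mathbb{R}^n$. Let $\mu_1,\mu_2:\mathrm{Lip}(S^{n-1})\to\mathbb{R}$ be valuations that are continuous with respect to $\tau$. If $\mu_1=\mu_2$ on $\mathcal{H}(S^{n-1})$, then $\mu_1=\mu_2$ on $\mathrm{Lip}(S^{n-1})$. -/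

import Mathlib

open Filter Topology MeasureTheory Asymptotics
open scoped NNReal

noncomputable section

/-- The unit sphere of the Euclidean space `ℝⁿ`, with the metric induced by the Euclidean norm. -/
abbrev USphere (n : ℕ) : Type :=
  Metric.sphere (0 : EuclideanSpace ℝ (Fin n)) 1

/-- The set of real-valued Lipschitz functions on the unit sphere of `ℝⁿ`. -/
@[ext]
structure LipSphere (n : ℕ) where
  toFun : USphere n → ℝ
  lipschitz' : ∃ L : ℝ≥0, LipschitzWith L toFun

namespace LipSphere

variable {n : ℕ}

instance : CoeFun (LipSphere n) (fun _ => USphere n → ℝ) := ⟨toFun⟩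

/-- The pointwise maximum `u ∨ v`. -/
instance : Max (LipSphere n) where
  max u v :=
    { toFun := fun x => max (u x) (v x)
      lipschitz' := by
        obtain ⟨L, hL⟩ := u.lipschitz'
        obtain ⟨M, hM⟩ := v.lipschitz'
        exact ⟨max L M, hL.max hM⟩ }

/-- The pointwise minimum `u ∧ v`. -/
instance : Min (LipSphere n) where
  min u v :=
    { toFun := fun x => min (u x) (v x)
      lipschitz' := by
        obtain ⟨L, hL⟩ := u.lipschitz'
        obtain ⟨M, hM⟩ := v.lipschitz'
        exact ⟨max L M, hL.min hM⟩ }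

end LipSphere

/-- `u` is differentiable at the point `x` of the sphere, and its differential on the tangent
space `T_x = {v | ⟪v, x⟫ = 0}` is represented by the tangent vector `g`. -/
def HasSphericalGradientAt {n : ℕ} (u : USphere n → ℝ) (g : EuclideanSpace ℝ (Fin n))
    (x : USphere n) : Prop :=
  inner ℝ g (x : EuclideanSpace ℝ (Fin n)) = 0 ∧
    (fun y : USphere n => u y - u x -
        inner ℝ g ((y : EuclideanSpace ℝ (Fin n)) - (x : EuclideanSpace ℝ (Fin n))))
      =o[𝓝 x]
    (fun y : USphere n => (y : EuclideanSpace ℝ (Fin n)) - (x : EuclideanSpace ℝ (Fin n)))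

/-- The spherical gradient is unique. -/
theorem HasSphericalGradientAt.unique {n : ℕ} {u : USphere n → ℝ}
    {g g' : EuclideanSpace ℝ (Fin n)} {x : USphere n} (h : HasSphericalGradientAt u g x)
    (h' : HasSphericalGradientAt u g' x) : g = g' := by
  by_contra hne
  set d := g' - g with hd
  have hd0 : 0 < ‖d‖ := norm_pos_iff.2 (sub_ne_zero.2 (Ne.symm hne))
  have hdx : inner ℝ d (x : EuclideanSpace ℝ (Fin n)) = 0 := by
    rw [hd, inner_sub_left, h.1, h'.1, sub_zero]
  have hx : ‖(x : EuclideanSpace ℝ (Fin n))‖ = 1 := by simp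
  set v := ‖d‖⁻¹ • d with hvd
  have hv : ‖v‖ = 1 := by rw [hvd, norm_smul]; simp [hd0.ne']
  have hdv : inner ℝ d v = ‖d‖ := by
    rw [hvd, inner_smul_right, real_inner_self_eq_norm_sq]; field_simp
  have hxv : inner ℝ (x : EuclideanSpace ℝ (Fin n)) v = 0 := by
    rw [hvd, inner_smul_right, real_inner_comm, hdx, mul_zero]
  let f : ℝ → EuclideanSpace ℝ (Fin n) := fun t => Real.cos t • (x : EuclideanSpace ℝ (Fin n)) + Real.sin t • v
  have hf : ∀ t, f t ∈ Metric.sphere (0 : EuclideanSpace ℝ (Fin n)) 1 := by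
    intro t
    rw [mem_sphere_zero_iff_norm, ← sq_eq_sq₀ (norm_nonneg _) zero_le_one]
    simp only [f]
    rw [norm_add_sq_real, inner_smul_left, inner_smul_right, hxv, norm_smul, norm_smul, hx, hv]
    simp
  let c : ℝ → USphere n := fun t => ⟨f t, hf t⟩
  have hc : Tendsto c (𝓝 0) (𝓝 x) := by
    have : Continuous c := by
      refine Continuous.subtype_mk ?_ _
      fun_prop
    have h0 : c 0 = x := by ext; simp [c, f]
    simpa [h0] using this.tendsto 0
  have hlo := (h.2.sub h'.2).comp_tendsto hc
  have hder : HasDerivAt f v 0 := by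
    have := ((Real.hasDerivAt_cos 0).smul_const (x : EuclideanSpace ℝ (Fin n))).add
      ((Real.hasDerivAt_sin 0).smul_const v)
    simp only [Real.sin_zero, Real.cos_zero, neg_zero, zero_smul, one_smul, zero_add] at this
    exact this
  have hO : (fun t => f t - x) =O[𝓝 0] (fun t : ℝ => t) := by
    have := hder.isBigO_sub
    simpa [f] using this
  have h3 := hlo.trans_isBigO hO
  have h4 : (fun t => ‖d‖ * Real.sin t) =o[𝓝 0] (fun t : ℝ => t) := by
    refine h3.congr_left fun t => ?_
    simp only [Function.comp, c]
    have e1 : inner ℝ g' (f t - x) - inner ℝ g (f t - x) = ‖d‖ * Real.sin t := by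
      rw [← inner_sub_left, ← hd]
      simp only [f, inner_sub_right, inner_add_right, inner_smul_right, hdx, hdv]
      ring
    linarith
  have h5 : HasDerivAt (fun t => ‖d‖ * Real.sin t) 0 0 := by
    rw [hasDerivAt_iff_isLittleO]; simpa using h4
  have h6 := (((Real.hasDerivAt_sin 0).const_mul ‖d‖).unique h5)
  simp at h6
  exact hne (sub_eq_zero.1 (by rw [← hd]; exact h6)).symm

open Classical in
/-- The spherical gradient `∇u(x)`, with the value `0` where `u` is not differentiable. -/
def sphericalGradient {n : ℕ} (u : USphere n → ℝ) (x : USphere n) : EuclideanSpace ℝ (Fin n) :=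
  if h : ∃ g, HasSphericalGradientAt u g x then h.choose else 0

/-- The `(n-1)`-dimensional Hausdorff measure on the unit sphere of `ℝⁿ`. -/
def sphereHausdorff (n : ℕ) : Measure (USphere n) :=
  Measure.hausdorffMeasure ((n : ℝ) - 1)

namespace LipSphere

variable {n : ℕ}

/-- The convergence `uᵢ → u`: uniform convergence, almost everywhere convergence of the spherical
gradients, and a uniform bound for the spherical gradients. -/
structure TauTendsto (s : ℕ → LipSphere n) (u : LipSphere n) : Prop where
  uniform : TendstoUniformly (fun i x => s i x) u atTop
  gradient : ∀ᵐ x ∂(sphereHausdorff n),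
    Tendsto (fun i => sphericalGradient (s i) x) atTop (𝓝 (sphericalGradient u x))
  bound : ∃ C : ℝ, 0 < C ∧ ∀ i, ∀ᵐ x ∂(sphereHausdorff n), ‖sphericalGradient (s i) x‖ ≤ C

/-- The topology `τ` induced by the convergence `TauTendsto`: a set is open if every sequence that
converges to one of its points is eventually in the set. -/
instance tau : TopologicalSpace (LipSphere n) where
  IsOpen U := ∀ u ∈ U, ∀ s : ℕ → LipSphere n, TauTendsto s u → ∀ᶠ i in atTop, s i ∈ U
  isOpen_univ := fun _ _ _ _ => Eventually.of_forall fun _ => trivial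
  isOpen_inter := fun _ _ hU hV u hu s hs => (hU u hu.1 s hs).and (hV u hu.2 s hs)
  isOpen_sUnion := fun _ h u hu s hs => by
    obtain ⟨U, hUS, huU⟩ := hu
    exact (h U hUS u huU s hs).mono fun _ hi => ⟨U, hUS, hi⟩

/-- A valuation on the space of Lipschitz functions on the sphere. -/
def IsValuation (μ : LipSphere n → ℝ) : Prop :=
  ∀ u v : LipSphere n, μ (max u v) + μ (min u v) = μ u + μ v

end LipSphere

/-- The support function `h_K(x) = max {⟪x, y⟫ | y ∈ K}` of a (non-empty, compact, convex) body;
the maximum exists, so that it is the supremum. -/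
def supportFunction {n : ℕ} (K : ConvexBody (EuclideanSpace ℝ (Fin n)))
    (x : EuclideanSpace ℝ (Fin n)) : ℝ :=
  sSup ((fun y => inner ℝ x y) '' (K : Set (EuclideanSpace ℝ (Fin n))))

theorem isGreatest_supportFunction {n : ℕ} (K : ConvexBody (EuclideanSpace ℝ (Fin n)))
    (x : EuclideanSpace ℝ (Fin n)) :
    IsGreatest ((fun y => inner ℝ x y) '' (K : Set (EuclideanSpace ℝ (Fin n))))
      (supportFunction K x) :=
  (K.isCompact.image (by fun_prop)).isGreatest_sSup (K.nonempty.image _)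

theorem lipschitz_supportFunction {n : ℕ} (K : ConvexBody (EuclideanSpace ℝ (Fin n))) :
    ∃ L : ℝ≥0, LipschitzWith L (supportFunction K) := by
  obtain ⟨R, hR⟩ := K.isCompact.isBounded.exists_norm_le
  refine ⟨R.toNNReal, LipschitzWith.of_le_add_mul _ fun x z => ?_⟩
  obtain ⟨y, hy, hxy⟩ := (isGreatest_supportFunction K x).1
  have h1 : inner ℝ z y ≤ supportFunction K z :=
    (isGreatest_supportFunction K z).2 ⟨y, hy, rfl⟩
  have h2 : inner ℝ (x - z) y ≤ ‖x - z‖ * ‖y‖ := real_inner_le_norm _ _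
  have h3 : ‖x - z‖ * ‖y‖ ≤ ‖x - z‖ * R := by gcongr; exact hR y hy
  have h4 : ‖x - z‖ * R ≤ ‖x - z‖ * (R.toNNReal : ℝ) := by
    gcongr; exact Real.le_coe_toNNReal R
  rw [inner_sub_left] at h2
  rw [dist_eq_norm, mul_comm]
  simp only at hxy
  linarith

namespace LipSphere

/-- The restriction to the unit sphere of the support function of a convex body. -/
def ofConvexBody {n : ℕ} (K : ConvexBody (EuclideanSpace ℝ (Fin n))) : LipSphere n where
  toFun := fun x => supportFunction K x
  lipschitz' := by
    obtain ⟨L, hL⟩ := lipschitz_supportFunction K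
    exact ⟨L * 1, hL.comp (LipschitzWith.subtype_val _)⟩

/-- The set `H(Sⁿ⁻¹)` of the restrictions to the unit sphere of support functions. -/
def supportFunctions (n : ℕ) : Set (LipSphere n) :=
  Set.range ofConvexBody

end LipSphere

end

/-!
Let `μ₁`, `μ₂` be continuous valuations that agree on support functions. The maximum of two support
functions is a support function (`LipSphere.supClosed_supportFunctions`), so the valuation property
gives `μ₁ = μ₂` on all finite minima of support functions (`valuation_eq_finset_inf'`). It remains
to see that these minima are sequentially dense for the convergence `τ`.

The sequence converging to `u` is explicit: `LipSphere.infConv` is the inf-convolution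
`x ↦ min {u y + ‖y - x‖² / (2t) | y ∈ Y}` over a finite `t²`-net `Y` of the sphere, with `t → 0`. As
`‖y - x‖² = 2 - 2 ⟪x, y⟫` on the sphere, each function in the minimum equals
`(u y + 1 / t) ‖x‖ - ⟪x, y / t⟫` there, which for small `t` is the support function of a ball
(`LipSphere.affine_mem_supportFunctions`).

A point `y` that realises the minimum at `x` is at distance `O(t)` from `x`, with a constant that
depends only on the Lipschitz constant of `u`. Where the inf-convolution is differentiable, its
gradient is the tangential part of `(x - y) / t` (`LipSphere.gradient_infConv`), which gives the
gradient bound. If `u` is differentiable at `x`, comparing `y` with a point of the net near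
`x - t ∇u(x)` shows `(x - y) / t → ∇u(x)` (`LipSphere.tendsto_minimizer`). Almost all `x` are points
of differentiability of `u` and of all the inf-convolutions, by Rademacher's theorem on the sphere
(`LipschitzWith.ae_exists_hasSphericalGradientAt`).
-/

/-! ### Valuations on distributive lattices -/

/-- Two valuations that agree on a sup-closed set agree on all finite infima of its elements.
This replaces inclusion-exclusion: `a ⊔ (b₁ ⊓ ⋯ ⊓ bₖ)` is an infimum of the `k` elements `a ⊔ bᵢ` of
the set, so that the valuation property reduces the number of elements by one. -/
theorem valuation_eq_finset_inf' {α ι : Type*} [DistribLattice α] {H : Set α} (hH : SupClosed H)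
    {μ₁ μ₂ : α → ℝ} (hv₁ : ∀ u v, μ₁ (u ⊔ v) + μ₁ (u ⊓ v) = μ₁ u + μ₁ v)
    (hv₂ : ∀ u v, μ₂ (u ⊔ v) + μ₂ (u ⊓ v) = μ₂ u + μ₂ v) (h : ∀ u ∈ H, μ₁ u = μ₂ u)
    {s : Finset ι} (hs : s.Nonempty) (f : ι → α) (hf : ∀ i ∈ s, f i ∈ H) :
    μ₁ (s.inf' hs f) = μ₂ (s.inf' hs f) := by
  induction hs using Finset.Nonempty.cons_induction generalizing f with
  | singleton a => simpa using h _ (hf a (by simp))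
  | cons a s ha hs ih =>
    have h1 := ih f fun i hi => hf i (Finset.mem_cons_of_mem hi)
    have h2 := ih (fun i => f a ⊔ f i) fun i hi =>
      hH (hf a (Finset.mem_cons_self a s)) (hf i (Finset.mem_cons_of_mem hi))
    have h3 : f a ⊔ s.inf' hs f = s.inf' hs fun i => f a ⊔ f i :=
      Finset.apply_inf'_eq_inf'_comp hs (fun x => f a ⊔ x) fun _ _ => sup_inf_left _ _ _
    have h4 := h _ (hf a (Finset.mem_cons_self a s))
    have h5 := hv₁ (f a) (s.inf' hs f)
    have h6 := hv₂ (f a) (s.inf' hs f)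
    rw [h3] at h5 h6
    rw [Finset.inf'_cons hs]
    linarith

namespace LipSphere

variable {n : ℕ}

/-- The pointwise order, whose lattice operations are the pointwise maximum and minimum. -/
instance : LE (LipSphere n) := ⟨fun u v => u.toFun ≤ v.toFun⟩

instance : LT (LipSphere n) := ⟨fun u v => u.toFun < v.toFun⟩

instance : DistribLattice (LipSphere n) :=
  Function.Injective.distribLattice toFun (fun _ _ h => LipSphere.ext h) Iff.rfl Iff.rfl
    (fun _ _ => rfl) (fun _ _ => rfl)

theorem finset_inf'_apply {ι : Type*} {s : Finset ι} (hs : s.Nonempty) (f : ι → LipSphere n)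
    (x : USphere n) : (s.inf' hs f) x = s.inf' hs fun i => f i x :=
  Finset.apply_inf'_eq_inf'_comp hs (fun u : LipSphere n => u x) fun _ _ => rfl

/-! ### Support functions -/

/-- The maximum of two support functions is the support function of the closed convex hull of the
union. -/
theorem supClosed_supportFunctions : SupClosed (supportFunctions n) := by
  rintro _ ⟨K, rfl⟩ _ ⟨L, rfl⟩
  set C : Set (EuclideanSpace ℝ (Fin n)) := closure (convexHull ℝ (K ∪ L)) with hC
  have hsub : (K ∪ L : Set (EuclideanSpace ℝ (Fin n))) ⊆ C :=
    (subset_convexHull ℝ _).trans subset_closure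
  refine ⟨⟨C, (convex_convexHull ℝ _).closure, ?_, ?_⟩, ?_⟩
  · refine Metric.isCompact_of_isClosed_isBounded isClosed_closure (Bornology.IsBounded.closure ?_)
    exact isBounded_convexHull.2 (K.isBounded.union L.isBounded)
  · exact K.nonempty.mono (Set.subset_union_left.trans hsub)
  · ext x
    refine (isGreatest_supportFunction _ _).unique (?_ : IsGreatest _
      (max (supportFunction K x) (supportFunction L x)))
    obtain ⟨⟨y, hy, hxy⟩, hK⟩ := isGreatest_supportFunction K x
    obtain ⟨⟨z, hz, hxz⟩, hL⟩ := isGreatest_supportFunction L x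
    constructor
    · rcases max_choice (supportFunction K x) (supportFunction L x) with h | h <;> rw [h]
      · exact ⟨y, hsub (Or.inl hy), hxy⟩
      · exact ⟨z, hsub (Or.inr hz), hxz⟩
    · rintro _ ⟨w, hw, rfl⟩
      refine closure_minimal (convexHull_min (t := {w : EuclideanSpace ℝ (Fin n) |
        inner ℝ (x : EuclideanSpace ℝ (Fin n)) w ≤
          max (supportFunction K x) (supportFunction L x)}) ?_ ?_) ?_ hw
      · rintro w (hw | hw)
        · exact le_max_of_le_left (hK ⟨w, hw, rfl⟩)
        · exact le_max_of_le_right (hL ⟨w, hw, rfl⟩)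
      · exact convex_halfSpace_le (innerₗ _ _).isLinear _
      · exact isClosed_le (by fun_prop) continuous_const

/-- The restriction of the affine function `x ↦ a + ⟪x, b⟫` to the sphere. -/
noncomputable def affine (a : ℝ) (b : EuclideanSpace ℝ (Fin n)) : LipSphere n where
  toFun := fun x => a + inner ℝ (x : EuclideanSpace ℝ (Fin n)) b
  lipschitz' := by
    refine ⟨‖b‖₊, LipschitzWith.of_dist_le_mul fun x y => ?_⟩
    rw [dist_add_left, Real.dist_eq, ← inner_sub_left, Subtype.dist_eq, dist_eq_norm, mul_comm]
    exact abs_real_inner_le_norm _ _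

theorem affine_apply (a : ℝ) (b : EuclideanSpace ℝ (Fin n)) (x : USphere n) :
    affine a b x = a + inner ℝ (x : EuclideanSpace ℝ (Fin n)) b := rfl

/-- For `a ≥ 0` the function `x ↦ a + ⟪x, b⟫` is on the sphere the support function of the closed
ball with centre `b` and radius `a`. -/
theorem affine_mem_supportFunctions {a : ℝ} (ha : 0 ≤ a) (b : EuclideanSpace ℝ (Fin n)) :
    affine a b ∈ supportFunctions n := by
  refine ⟨⟨Metric.closedBall b a, convex_closedBall b a, isCompact_closedBall b a,
    Metric.nonempty_closedBall.2 ha⟩, ?_⟩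
  ext x
  have hx : ‖(x : EuclideanSpace ℝ (Fin n))‖ = 1 := by simp
  refine (isGreatest_supportFunction _ _).unique
    ⟨⟨b + a • (x : EuclideanSpace ℝ (Fin n)), ?_, ?_⟩, ?_⟩
  · simp [norm_smul, hx, abs_of_nonneg ha]
  · change inner ℝ (x : EuclideanSpace ℝ (Fin n)) (b + a • (x : EuclideanSpace ℝ (Fin n))) =
      a + inner ℝ (x : EuclideanSpace ℝ (Fin n)) b
    rw [inner_add_right, inner_smul_right, real_inner_self_eq_norm_sq, hx]
    ring
  · rintro _ ⟨y, hy, rfl⟩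
    have h1 := real_inner_le_norm (x : EuclideanSpace ℝ (Fin n)) (y - b)
    have h2 : ‖y - b‖ ≤ a := mem_closedBall_iff_norm.1 hy
    rw [hx, one_mul, inner_sub_right] at h1
    change inner ℝ (x : EuclideanSpace ℝ (Fin n)) y ≤ a + inner ℝ (x : EuclideanSpace ℝ (Fin n)) b
    linarith

end LipSphere

/-! ### Spherical gradients -/

/-- Every tangent vector of the sphere is the velocity of a curve in the sphere. -/
theorem exists_sphere_curve {n : ℕ} (x : USphere n) {v : EuclideanSpace ℝ (Fin n)}
    (hv : inner ℝ v (x : EuclideanSpace ℝ (Fin n)) = 0) :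
    ∃ c : ℝ → USphere n, c 0 = x ∧
      HasDerivAt (fun t => (c t : EuclideanSpace ℝ (Fin n))) v 0 := by
  have hx : ‖(x : EuclideanSpace ℝ (Fin n))‖ = 1 := by simp
  set r : ℝ → ℝ := fun t => (√(1 + t ^ 2 * ‖v‖ ^ 2))⁻¹ with hr
  have hpos : ∀ t : ℝ, 0 < 1 + t ^ 2 * ‖v‖ ^ 2 := fun t => by positivity
  have hnorm : ∀ t : ℝ, ‖r t • ((x : EuclideanSpace ℝ (Fin n)) + t • v)‖ = 1 := by
    intro t
    have h1 : ‖(x : EuclideanSpace ℝ (Fin n)) + t • v‖ = √(1 + t ^ 2 * ‖v‖ ^ 2) := by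
      rw [← Real.sqrt_sq (norm_nonneg ((x : EuclideanSpace ℝ (Fin n)) + t • v)),
        norm_add_sq_real, hx, inner_smul_right, real_inner_comm, hv, norm_smul, mul_pow,
        Real.norm_eq_abs, sq_abs]
      ring_nf
    rw [norm_smul, h1, hr, Real.norm_eq_abs, abs_of_pos (inv_pos.2 (Real.sqrt_pos.2 (hpos t)))]
    exact inv_mul_cancel₀ (Real.sqrt_pos.2 (hpos t)).ne'
  refine ⟨fun t => ⟨r t • ((x : EuclideanSpace ℝ (Fin n)) + t • v),
    mem_sphere_zero_iff_norm.2 (hnorm t)⟩, ?_, ?_⟩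
  · ext
    simp [hr]
  · have h1 : HasDerivAt (fun t : ℝ => 1 + t ^ 2 * ‖v‖ ^ 2) 0 0 := by
      simpa using ((hasDerivAt_pow 2 (0 : ℝ)).mul_const (‖v‖ ^ 2)).const_add 1
    have h2 : HasDerivAt r 0 0 :=
      ((h1.sqrt (hpos 0).ne').fun_inv (Real.sqrt_pos.2 (hpos 0)).ne').congr_deriv (by simp)
    have h3 : HasDerivAt (fun t : ℝ => (x : EuclideanSpace ℝ (Fin n)) + t • v) v 0 := by
      simpa using ((hasDerivAt_id (0 : ℝ)).smul_const v).const_add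
        (x : EuclideanSpace ℝ (Fin n))
    exact (h2.fun_smul h3).congr_deriv (by simp [hr])

namespace HasSphericalGradientAt

variable {n : ℕ} {u f : USphere n → ℝ} {g g' : EuclideanSpace ℝ (Fin n)} {x : USphere n}

theorem sphericalGradient_eq (h : HasSphericalGradientAt u g x) : sphericalGradient u x = g := by
  have hex : ∃ g, HasSphericalGradientAt u g x := ⟨g, h⟩
  rw [sphericalGradient, dif_pos hex]
  exact hex.choose_spec.unique h

theorem sub (h : HasSphericalGradientAt u g x) (h' : HasSphericalGradientAt f g' x) :
    HasSphericalGradientAt (fun y => u y - f y) (g - g') x := by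
  refine ⟨by rw [inner_sub_left, h.1, h'.1, sub_zero], (h.2.sub h'.2).congr_left fun y => ?_⟩
  rw [inner_sub_left]
  ring

/-- Chain rule along a curve in the sphere. -/
theorem hasDerivAt_comp (h : HasSphericalGradientAt u g x) {c : ℝ → USphere n} (h0 : c 0 = x)
    {v : EuclideanSpace ℝ (Fin n)}
    (hc : HasDerivAt (fun t => (c t : EuclideanSpace ℝ (Fin n))) v 0) :
    HasDerivAt (fun t => u (c t)) (inner ℝ g v) 0 := by
  subst h0
  have hcont : Tendsto c (𝓝 0) (𝓝 (c 0)) := tendsto_subtype_rng.2 hc.continuousAt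
  have h1 := (h.2.comp_tendsto hcont).trans_isBigO hc.isBigO_sub
  have h2 : HasDerivAt (fun t => u (c t) - inner ℝ g (c t : EuclideanSpace ℝ (Fin n))) 0 0 := by
    rw [hasDerivAt_iff_isLittleO]
    refine h1.congr_left fun t => ?_
    simp only [Function.comp, inner_sub_right, smul_zero]
    ring
  have h3 : HasDerivAt (fun t => inner ℝ g (c t : EuclideanSpace ℝ (Fin n))) (inner ℝ g v) 0 :=
    (innerSL ℝ g).hasFDerivAt.comp_hasDerivAt 0 hc
  simpa using h2.fun_add h3

/-- Two functions that touch at a point have the same gradient there. -/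
theorem eq_of_le (h : HasSphericalGradientAt u g x) (h' : HasSphericalGradientAt f g' x)
    (hle : ∀ y, u y ≤ f y) (hx : u x = f x) : g = g' := by
  have hs := h'.sub h
  obtain ⟨c, hc0, hc⟩ := exists_sphere_curve x hs.1
  have hmin : IsLocalMin (fun t => f (c t) - u (c t)) 0 :=
    Eventually.of_forall fun t => by
      simp only [hc0, hx, sub_self]
      exact sub_nonneg.2 (hle _)
  have h0 := hmin.hasDerivAt_eq_zero (hs.hasDerivAt_comp hc0 hc)
  exact (sub_eq_zero.1 (inner_self_eq_zero.1 h0)).symm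

/-- If `u` agrees near `x` with a function on the ambient space that is differentiable at `x`, then
the spherical gradient of `u` at `x` is the tangential part of the ambient gradient. -/
theorem of_hasFDerivAt {F : EuclideanSpace ℝ (Fin n) → ℝ}
    (hF : HasFDerivAt F (innerSL ℝ g) (x : EuclideanSpace ℝ (Fin n)))
    (hu : ∀ᶠ y : USphere n in 𝓝 x, u y = F y) :
    HasSphericalGradientAt u (g - inner ℝ g (x : EuclideanSpace ℝ (Fin n)) •
      (x : EuclideanSpace ℝ (Fin n))) x := by
  have hx : ∀ x : USphere n, inner ℝ (x : EuclideanSpace ℝ (Fin n))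
      (x : EuclideanSpace ℝ (Fin n)) = 1 := fun x => by
    rw [real_inner_self_eq_norm_sq, mem_sphere_zero_iff_norm.1 x.2, one_pow]
  refine ⟨by rw [inner_sub_left, inner_smul_left, hx]; simp, ?_⟩
  have hval : Tendsto (fun y : USphere n => (y : EuclideanSpace ℝ (Fin n))) (𝓝 x) (𝓝 x) :=
    continuous_subtype_val.tendsto x
  have h1 := hF.isLittleO.comp_tendsto hval
  -- The normal part `⟪x, y - x⟫ = -‖y - x‖² / 2` is of second order.
  have h2 : (fun y : USphere n => inner ℝ g (x : EuclideanSpace ℝ (Fin n)) *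
      inner ℝ (x : EuclideanSpace ℝ (Fin n)) ((y : EuclideanSpace ℝ (Fin n)) - x)) =o[𝓝 x]
      (fun y : USphere n => (y : EuclideanSpace ℝ (Fin n)) - (x : EuclideanSpace ℝ (Fin n))) := by
    have h3 : (fun y : USphere n => (y : EuclideanSpace ℝ (Fin n)) - x) =o[𝓝 x]
        (fun _ => (1 : ℝ)) := by
      rw [isLittleO_one_iff]
      simpa using hval.sub_const (x : EuclideanSpace ℝ (Fin n))
    have h4 := (h3.norm_left.mul_isBigO (isBigO_refl (fun y : USphere n =>
      ‖(y : EuclideanSpace ℝ (Fin n)) - x‖) (𝓝 x))).const_mul_left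
      (-(inner ℝ g (x : EuclideanSpace ℝ (Fin n)) / 2))
    refine isLittleO_norm_right.1 ((h4.congr_right fun y => one_mul _).congr_left fun y => ?_)
    rw [← sq, ← real_inner_self_eq_norm_sq, inner_sub_right, inner_sub_left, inner_sub_left,
      inner_sub_right, hx, hx, real_inner_comm (x : EuclideanSpace ℝ (Fin n)) y]
    ring
  refine (h1.add h2).congr' ?_ EventuallyEq.rfl
  filter_upwards [hu] with y hy
  rw [hy, hu.self_of_nhds]
  simp only [Function.comp, innerSL_apply_apply, inner_sub_left, inner_smul_left,
    RCLike.conj_to_real]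
  ring

end HasSphericalGradientAt

/-! ### Rademacher's theorem on the sphere -/

/-- The radial projection onto the unit sphere is `2`-Lipschitz outside the open unit ball. -/
theorem norm_inv_norm_smul_sub_le {E : Type*} [NormedAddCommGroup E] [NormedSpace ℝ E] {a b : E}
    (ha : 1 ≤ ‖a‖) (hb : 1 ≤ ‖b‖) : ‖‖a‖⁻¹ • a - ‖b‖⁻¹ • b‖ ≤ 2 * ‖a - b‖ := by
  have ha0 : 0 < ‖a‖ := by linarith
  have hb0 : 0 < ‖b‖ := by linarith
  have h1 : ‖a‖⁻¹ • a - ‖b‖⁻¹ • b = ‖a‖⁻¹ • ((a - b) + ((‖b‖ - ‖a‖) * ‖b‖⁻¹) • b) := by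
    rw [smul_add, smul_sub, smul_smul, sub_mul, mul_sub, sub_smul, mul_inv_cancel₀ hb0.ne',
      mul_one, ← mul_assoc, inv_mul_cancel₀ ha0.ne', one_mul]
    abel
  have h2 : ‖((‖b‖ - ‖a‖) * ‖b‖⁻¹) • b‖ ≤ ‖a - b‖ := by
    rw [norm_smul, norm_mul, norm_inv, norm_norm, mul_assoc, inv_mul_cancel₀ hb0.ne', mul_one,
      norm_sub_rev a b]
    exact abs_norm_sub_norm_le b a
  rw [h1, norm_smul, norm_inv, norm_norm]
  calc ‖a‖⁻¹ * ‖a - b + ((‖b‖ - ‖a‖) * ‖b‖⁻¹) • b‖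
      ≤ 1 * ‖a - b + ((‖b‖ - ‖a‖) * ‖b‖⁻¹) • b‖ := by
        gcongr
        exact inv_le_one_of_one_le₀ ha
    _ ≤ 2 * ‖a - b‖ := by
        have := norm_add_le (a - b) (((‖b‖ - ‖a‖) * ‖b‖⁻¹) • b)
        linarith

/-- Rademacher's theorem on the sphere. The open hemisphere around `p` is the image of the tangent
space at `p` under the Lipschitz map `w ↦ (p + w) / ‖p + w‖`, whose inverse is smooth, so that the
claim reduces to Rademacher's theorem on the tangent space, where the Hausdorff measure is a Haar
measure. -/
theorem LipschitzWith.ae_exists_hasSphericalGradientAt {n : ℕ} (hn : 1 ≤ n) {u : USphere n → ℝ}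
    {L : ℝ≥0} (hu : LipschitzWith L u) :
    ∀ᵐ x ∂(sphereHausdorff n), ∃ g, HasSphericalGradientAt u g x := by
  refine measure_null_of_locally_null (μ := sphereHausdorff n) _ fun p _ => ?_
  have hp : ‖(p : EuclideanSpace ℝ (Fin n))‖ = 1 := by simp
  set T := (ℝ ∙ (p : EuclideanSpace ℝ (Fin n)))ᗮ with hT
  have hpT : ∀ w : T, inner ℝ (p : EuclideanSpace ℝ (Fin n)) (w : EuclideanSpace ℝ (Fin n)) = 0 :=
    fun w => Submodule.mem_orthogonal_singleton_iff_inner_right.1 w.2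
  have hnorm : ∀ w : T, 1 ≤ ‖(p : EuclideanSpace ℝ (Fin n)) + w‖ := by
    intro w
    have h1 : ‖(p : EuclideanSpace ℝ (Fin n)) + w‖ ^ 2 =
        1 + ‖(w : EuclideanSpace ℝ (Fin n))‖ ^ 2 := by
      rw [norm_add_sq_real, hpT, hp]
      ring
    have h2 := sq_nonneg ‖(w : EuclideanSpace ℝ (Fin n))‖
    exact (one_le_sq_iff₀ (norm_nonneg _)).1 (by linarith)
  let φ : T → USphere n := fun w =>
    ⟨‖(p : EuclideanSpace ℝ (Fin n)) + w‖⁻¹ • ((p : EuclideanSpace ℝ (Fin n)) + w), by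
      have := hnorm w
      rw [mem_sphere_zero_iff_norm, norm_smul, norm_inv, norm_norm]
      exact inv_mul_cancel₀ (by linarith)⟩
  have hφ : LipschitzWith 2 φ := LipschitzWith.of_dist_le_mul fun w z => by
    rw [Subtype.dist_eq, dist_eq_norm, dist_eq_norm]
    refine (norm_inv_norm_smul_sub_le (hnorm w) (hnorm z)).trans_eq ?_
    rw [add_sub_add_left_eq_sub, ← Submodule.coe_sub, Submodule.coe_norm]
    rfl
  -- The inverse chart, written as a map on the ambient space so that `u ∘ φ ∘ ψ` extends `u`.
  let ψ : EuclideanSpace ℝ (Fin n) → T := fun y =>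
    (inner ℝ (p : EuclideanSpace ℝ (Fin n)) y)⁻¹ • T.orthogonalProjectionOnto y
  have hψ : ∀ y : USphere n,
      0 < inner ℝ (p : EuclideanSpace ℝ (Fin n)) (y : EuclideanSpace ℝ (Fin n)) → φ (ψ y) = y := by
    intro y hy
    set s := inner ℝ (p : EuclideanSpace ℝ (Fin n)) (y : EuclideanSpace ℝ (Fin n)) with hs
    have h1 : (p : EuclideanSpace ℝ (Fin n)) + ψ y = s⁻¹ • (y : EuclideanSpace ℝ (Fin n)) := by
      have h2 : ((T.orthogonalProjectionOnto (y : EuclideanSpace ℝ (Fin n)) : T) :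
          EuclideanSpace ℝ (Fin n)) = y - s • (p : EuclideanSpace ℝ (Fin n)) := by
        have h3 := Submodule.starProjection_orthogonal_val
          (K := ℝ ∙ (p : EuclideanSpace ℝ (Fin n))) (y : EuclideanSpace ℝ (Fin n))
        rw [Submodule.starProjection_unit_singleton ℝ hp] at h3
        exact h3
      simp only [ψ, Submodule.coe_smul]
      rw [h2, ← hs, smul_sub, smul_smul, inv_mul_cancel₀ hy.ne', one_smul]
      abel
    ext1
    simp only [φ]
    rw [h1, norm_smul, mem_sphere_zero_iff_norm.1 y.2, mul_one, Real.norm_eq_abs,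
      abs_of_pos (inv_pos.2 hy), inv_inv, smul_smul, mul_inv_cancel₀ hy.ne', one_smul]
  have hdim : ((Module.finrank ℝ T : ℕ) : ℝ) = (n : ℝ) - 1 := by
    have : Fact (Module.finrank ℝ (EuclideanSpace ℝ (Fin n)) = (n - 1) + 1) :=
      ⟨by rw [finrank_euclideanSpace_fin]; omega⟩
    rw [hT, Submodule.finrank_orthogonal_span_singleton (n := n - 1) (by
      rw [← norm_ne_zero_iff, hp]; exact one_ne_zero)]
    push_cast [hn]
    rfl
  have hN : Measure.hausdorffMeasure (Module.finrank ℝ T : ℝ)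
      {w : T | ¬ DifferentiableAt ℝ (fun w => u (φ w)) w} = 0 :=
    (hu.comp hφ).ae_differentiableAt
  have hN' : sphereHausdorff n (φ '' {w : T | ¬ DifferentiableAt ℝ (fun w => u (φ w)) w}) = 0 := by
    rw [hdim] at hN
    have h0 : (0 : ℝ) ≤ (n : ℝ) - 1 := by
      have : (1 : ℝ) ≤ n := by exact_mod_cast hn
      linarith
    have h1 := hφ.hausdorffMeasure_image_le h0 {w : T | ¬ DifferentiableAt ℝ (fun w => u (φ w)) w}
    rw [hN, mul_zero] at h1
    exact le_antisymm h1 bot_le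
  have hcont : Continuous fun y : USphere n =>
      inner ℝ (p : EuclideanSpace ℝ (Fin n)) (y : EuclideanSpace ℝ (Fin n)) := by fun_prop
  have hopen : IsOpen {y : USphere n |
      0 < inner ℝ (p : EuclideanSpace ℝ (Fin n)) (y : EuclideanSpace ℝ (Fin n))} :=
    isOpen_lt continuous_const hcont
  have hpmem : p ∈ {y : USphere n |
      0 < inner ℝ (p : EuclideanSpace ℝ (Fin n)) (y : EuclideanSpace ℝ (Fin n))} := by
    simp [hp]
  refine ⟨_, inter_mem_nhdsWithin _ (hopen.mem_nhds hpmem), measure_mono_null ?_ hN'⟩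
  rintro y ⟨hy, hy0⟩
  refine ⟨ψ y, fun hd => hy ?_, hψ y hy0⟩
  have hψd : DifferentiableAt ℝ ψ (y : EuclideanSpace ℝ (Fin n)) := by
    have h1 : DifferentiableAt ℝ (fun z => inner ℝ (p : EuclideanSpace ℝ (Fin n)) z)
        (y : EuclideanSpace ℝ (Fin n)) :=
      (innerSL ℝ (p : EuclideanSpace ℝ (Fin n))).differentiableAt
    have h2 : 0 < inner ℝ (p : EuclideanSpace ℝ (Fin n)) (y : EuclideanSpace ℝ (Fin n)) := hy0
    exact (h1.fun_inv h2.ne').fun_smul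
      T.orthogonalProjectionOnto.differentiableAt
  have hF := (hd.comp (y : EuclideanSpace ℝ (Fin n)) hψd).hasFDerivAt
  obtain ⟨g, hg⟩ := (InnerProductSpace.toDual ℝ (EuclideanSpace ℝ (Fin n))).surjective
    (fderiv ℝ ((fun w => u (φ w)) ∘ ψ) (y : EuclideanSpace ℝ (Fin n)))
  rw [← hg] at hF
  refine ⟨_, HasSphericalGradientAt.of_hasFDerivAt (g := g) hF ?_⟩
  filter_upwards [hopen.mem_nhds hy0] with z hz
  simp only [Function.comp]
  rw [hψ z hz]

/-! ### Discrete inf-convolutions -/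

namespace LipSphere

variable {n : ℕ}

/-- The function `x ↦ u y + ‖y - x‖² / (2t)` on the sphere. It is the restriction of an affine
function, since `‖y - x‖² = 2 - 2 ⟪x, y⟫` there. -/
noncomputable def parabola (u : LipSphere n) (t : ℝ) (y : USphere n) : LipSphere n :=
  affine (u y + t⁻¹) (-t⁻¹ • (y : EuclideanSpace ℝ (Fin n)))

/-- The inf-convolution `x ↦ min {u y + ‖y - x‖² / (2t) | y ∈ Y}` of `u` with a parabola, over a
finite set `Y` of points of the sphere. -/
noncomputable def infConv (u : LipSphere n) (t : ℝ) {Y : Finset (USphere n)} (hY : Y.Nonempty) :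
    LipSphere n :=
  Y.inf' hY (u.parabola t)

theorem inner_self_eq_one (x : USphere n) :
    inner ℝ (x : EuclideanSpace ℝ (Fin n)) (x : EuclideanSpace ℝ (Fin n)) = 1 := by
  rw [real_inner_self_eq_norm_sq, mem_sphere_zero_iff_norm.1 x.2, one_pow]

theorem parabola_apply (u : LipSphere n) (t : ℝ) (y x : USphere n) :
    u.parabola t y x =
      u y + ‖(y : EuclideanSpace ℝ (Fin n)) - (x : EuclideanSpace ℝ (Fin n))‖ ^ 2 / (2 * t) := by
  rw [parabola, affine_apply, inner_smul_right, ← real_inner_self_eq_norm_sq, inner_sub_left,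
    inner_sub_right, inner_sub_right, inner_self_eq_one, inner_self_eq_one,
    real_inner_comm (x : EuclideanSpace ℝ (Fin n)) y]
  rcases eq_or_ne t 0 with rfl | ht
  · simp
  · field_simp
    ring

theorem infConv_le (u : LipSphere n) (t : ℝ) {Y : Finset (USphere n)} (hY : Y.Nonempty)
    {y : USphere n} (hy : y ∈ Y) (x : USphere n) : u.infConv t hY x ≤ u.parabola t y x := by
  rw [infConv, finset_inf'_apply]
  exact Finset.inf'_le (fun y => u.parabola t y x) hy

theorem exists_infConv_eq (u : LipSphere n) (t : ℝ) {Y : Finset (USphere n)} (hY : Y.Nonempty)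
    (x : USphere n) : ∃ y ∈ Y, u.infConv t hY x = u.parabola t y x := by
  obtain ⟨y, hy, h⟩ := Finset.exists_mem_eq_inf' hY fun y => u.parabola t y x
  exact ⟨y, hy, by rw [infConv, finset_inf'_apply, h]⟩

/-- Where an inf-convolution is differentiable, its gradient is that of any parabola that realises
the minimum. -/
theorem gradient_infConv {u : LipSphere n} {t : ℝ} {Y : Finset (USphere n)} {hY : Y.Nonempty}
    {x y : USphere n} {g : EuclideanSpace ℝ (Fin n)} (hy : y ∈ Y)
    (hxy : u.infConv t hY x = u.parabola t y x)
    (hg : HasSphericalGradientAt (u.infConv t hY) g x) :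
    g = -(t⁻¹ • ((y : EuclideanSpace ℝ (Fin n)) - x) -
      inner ℝ (t⁻¹ • ((y : EuclideanSpace ℝ (Fin n)) - x)) (x : EuclideanSpace ℝ (Fin n)) •
        (x : EuclideanSpace ℝ (Fin n))) := by
  have hF : HasFDerivAt (fun z : EuclideanSpace ℝ (Fin n) =>
      u y + t⁻¹ + innerSL ℝ (-t⁻¹ • (y : EuclideanSpace ℝ (Fin n))) z)
      (innerSL ℝ (-t⁻¹ • (y : EuclideanSpace ℝ (Fin n)))) x :=
    (innerSL ℝ (-t⁻¹ • (y : EuclideanSpace ℝ (Fin n)))).hasFDerivAt.const_add _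
  have h1 : HasSphericalGradientAt (u.parabola t y) _ x :=
    HasSphericalGradientAt.of_hasFDerivAt hF (Eventually.of_forall fun z => by
      rw [parabola, affine_apply, real_inner_comm, innerSL_apply_apply])
  rw [hg.eq_of_le h1 (infConv_le u t hY hy) hxy, inner_smul_left, inner_smul_left, inner_sub_left,
    inner_self_eq_one]
  simp only [RCLike.conj_to_real]
  module

/-- The tangential part of a vector is not longer than the vector. -/
theorem norm_sub_inner_smul_le (v : EuclideanSpace ℝ (Fin n)) (x : USphere n) :
    ‖v - inner ℝ v (x : EuclideanSpace ℝ (Fin n)) • (x : EuclideanSpace ℝ (Fin n))‖ ≤ ‖v‖ := by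
  refine (sq_le_sq₀ (norm_nonneg _) (norm_nonneg _)).1 ?_
  rw [norm_sub_sq_real, inner_smul_right, norm_smul, mem_sphere_zero_iff_norm.1 x.2, mul_one,
    Real.norm_eq_abs, sq_abs]
  nlinarith [sq_nonneg (inner ℝ v (x : EuclideanSpace ℝ (Fin n)))]

section Estimates

variable {u : LipSphere n} {L : ℝ≥0} {t : ℝ} {Y : Finset (USphere n)} {hY : Y.Nonempty}

theorem infConv_apply_le (hu : LipschitzWith L u) (ht : 0 < t) (ht1 : t ≤ 1)
    (hnet : ∀ x, ∃ y ∈ Y, dist y x ≤ t ^ 2) (x : USphere n) :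
    u.infConv t hY x ≤ u x + (L + 1 / 2) * t ^ 2 := by
  obtain ⟨y, hy, hxy⟩ := hnet x
  have h1 := infConv_le u t hY hy x
  rw [parabola_apply, ← dist_eq_norm, ← Subtype.dist_eq] at h1
  have h2 : u y - u x ≤ L * dist y x := (le_abs_self _).trans (hu.dist_le_mul y x)
  have h3 : (L : ℝ) * dist y x ≤ L * t ^ 2 := by gcongr
  have h4 : dist y x ^ 2 / (2 * t) ≤ (t ^ 2) ^ 2 / (2 * t) := by gcongr
  have h5 : (t ^ 2) ^ 2 / (2 * t) = t ^ 2 * t / 2 := by field_simp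
  have h6 : t ^ 2 * t ≤ t ^ 2 := mul_le_of_le_one_right (by positivity) ht1
  linarith

/-- The points that realise the minimum in the inf-convolution at `x` are at distance `O(t)` from
`x`. -/
theorem dist_le_of_infConv_eq (hu : LipschitzWith L u) (ht : 0 < t) (ht1 : t ≤ 1)
    (hnet : ∀ x, ∃ y ∈ Y, dist y x ≤ t ^ 2) {x y : USphere n}
    (hxy : u.infConv t hY x = u.parabola t y x) : dist y x ≤ (2 * L + 1) * t := by
  have h1 := infConv_apply_le (hY := hY) hu ht ht1 hnet x
  rw [hxy, parabola_apply, ← dist_eq_norm, ← Subtype.dist_eq] at h1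
  have h2 : u x - u y ≤ L * dist y x := by
    rw [dist_comm]
    exact (le_abs_self _).trans (hu.dist_le_mul x y)
  have h3 : dist y x ^ 2 / (2 * t) ≤ L * dist y x + (L + 1 / 2) * t ^ 2 := by linarith
  rw [div_le_iff₀ (by positivity)] at h3
  have hL : (0 : ℝ) ≤ L := L.2
  have h4 : (L + 1 / 2) * t ^ 2 * (2 * t) ≤ (2 * L + 1) * t ^ 2 := by
    have : (2 * L + 1) * t ^ 2 * t ≤ (2 * L + 1) * t ^ 2 :=
      mul_le_of_le_one_right (by positivity) ht1
    linarith
  -- Completing the square.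
  have h5 : (dist y x - L * t) ^ 2 ≤ ((L + 1) * t) ^ 2 := by nlinarith
  have h6 := abs_le_of_sq_le_sq' h5 (by positivity)
  linarith [h6.2]

theorem abs_infConv_sub_le (hu : LipschitzWith L u) (ht : 0 < t) (ht1 : t ≤ 1)
    (hnet : ∀ x, ∃ y ∈ Y, dist y x ≤ t ^ 2) (x : USphere n) :
    |u.infConv t hY x - u x| ≤ (2 * L + 1) * (L + 1) * t := by
  have hL : (0 : ℝ) ≤ L := L.2
  have ht2 : t ^ 2 ≤ t := by nlinarith
  have h1 := infConv_apply_le (hY := hY) hu ht ht1 hnet x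
  obtain ⟨y, -, hxy⟩ := exists_infConv_eq u t hY x
  have h2 := dist_le_of_infConv_eq hu ht ht1 hnet hxy
  rw [parabola_apply] at hxy
  have h3 : u x - u y ≤ L * dist y x := by
    rw [dist_comm]
    exact (le_abs_self _).trans (hu.dist_le_mul x y)
  have h4 : 0 ≤ ‖(y : EuclideanSpace ℝ (Fin n)) - x‖ ^ 2 / (2 * t) := by positivity
  have h5 : (L : ℝ) * dist y x ≤ L * ((2 * L + 1) * t) := by gcongr
  have h6 : (L + 1 / 2) * t ^ 2 ≤ (L + 1 / 2) * t := by gcongr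
  have h7 : 0 ≤ (L : ℝ) * L * t := by positivity
  have h8 : 0 ≤ (L : ℝ) * t := by positivity
  rw [abs_le]
  constructor <;> nlinarith

theorem norm_sphericalGradient_infConv_le (hu : LipschitzWith L u) (ht : 0 < t) (ht1 : t ≤ 1)
    (hnet : ∀ x, ∃ y ∈ Y, dist y x ≤ t ^ 2) (x : USphere n) :
    ‖sphericalGradient (u.infConv t hY) x‖ ≤ 2 * L + 1 := by
  by_cases hd : ∃ g, HasSphericalGradientAt (u.infConv t hY) g x
  · obtain ⟨g, hg⟩ := hd
    obtain ⟨y, hy, hxy⟩ := exists_infConv_eq u t hY x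
    rw [hg.sphericalGradient_eq, gradient_infConv hy hxy hg, norm_neg]
    refine (norm_sub_inner_smul_le _ _).trans ?_
    rw [norm_smul, norm_inv, Real.norm_eq_abs, abs_of_pos ht, ← dist_eq_norm, ← Subtype.dist_eq,
      inv_mul_le_iff₀ ht, mul_comm t]
    exact dist_le_of_infConv_eq hu ht ht1 hnet hxy
  · rw [sphericalGradient, dif_neg hd, norm_zero]
    positivity

end Estimates

/-- If the points `y k` do at least as well as `q k` in the inf-convolution with parameter `t k` at
`x`, and the `q k` leave `x` with the optimal velocity `-∇u(x)`, then so do the `y k`. With the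
remainder `r` of the first order expansion of `u` at `x`, completing the square gives
`u y + ‖y - x‖² / (2t) = u x + r y + (‖(y - x) + t ∇u(x)‖² - t² ‖∇u(x)‖²) / (2t)`. -/
theorem tendsto_minimizer {u : USphere n → ℝ} {g : EuclideanSpace ℝ (Fin n)} {x : USphere n}
    (hg : HasSphericalGradientAt u g x) {t : ℕ → ℝ} (ht : ∀ k, 0 < t k)
    (ht0 : Tendsto t atTop (𝓝 0)) {y q : ℕ → USphere n}
    (hy : (fun k => (y k : EuclideanSpace ℝ (Fin n)) - x) =O[atTop] t)
    (hq : Tendsto (fun k => (t k)⁻¹ • ((q k : EuclideanSpace ℝ (Fin n)) - x)) atTop (𝓝 (-g)))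
    (hle : ∀ k, u (y k) + ‖(y k : EuclideanSpace ℝ (Fin n)) - x‖ ^ 2 / (2 * t k) ≤
      u (q k) + ‖(q k : EuclideanSpace ℝ (Fin n)) - x‖ ^ 2 / (2 * t k)) :
    Tendsto (fun k => (t k)⁻¹ • ((y k : EuclideanSpace ℝ (Fin n)) - x)) atTop (𝓝 (-g)) := by
  have hqO : (fun k => (q k : EuclideanSpace ℝ (Fin n)) - x) =O[atTop] t := by
    have h1 := (isBigO_refl t atTop).smul (hq.isBigO_one ℝ)
    refine (h1.congr_left fun k => ?_).congr_right fun k => by simp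
    rw [smul_smul, mul_inv_cancel₀ (ht k).ne', one_smul]
  set r : USphere n → ℝ := fun z => u z - u x -
    inner ℝ g ((z : EuclideanSpace ℝ (Fin n)) - (x : EuclideanSpace ℝ (Fin n))) with hr
  have hrem : ∀ {p : ℕ → USphere n}, (fun k => (p k : EuclideanSpace ℝ (Fin n)) - x) =O[atTop] t →
      Tendsto (fun k => r (p k) / t k) atTop (𝓝 0) := fun {p} hp => by
    have h1 : Tendsto p atTop (𝓝 x) :=
      tendsto_subtype_rng.2 (tendsto_sub_nhds_zero_iff.1 (hp.trans_tendsto ht0))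
    exact ((hg.2.comp_tendsto h1).trans_isBigO hp).tendsto_div_nhds_zero
  have hsq : ∀ k, ‖(t k)⁻¹ • ((y k : EuclideanSpace ℝ (Fin n)) - x) + g‖ ^ 2 ≤
      ‖(t k)⁻¹ • ((q k : EuclideanSpace ℝ (Fin n)) - x) + g‖ ^ 2 +
        2 * (r (q k) / t k - r (y k) / t k) := by
    intro k
    have hk := ht k
    have h1 : ∀ z : USphere n, ‖(t k)⁻¹ • ((z : EuclideanSpace ℝ (Fin n)) - x) + g‖ ^ 2 =
        2 / t k * (u z + ‖(z : EuclideanSpace ℝ (Fin n)) - x‖ ^ 2 / (2 * t k)) -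
          2 * (r z / t k) + (‖g‖ ^ 2 - 2 / t k * u x) := by
      intro z
      rw [norm_add_sq_real, norm_smul, inner_smul_left, hr, Real.norm_eq_abs,
        abs_of_pos (inv_pos.2 hk), real_inner_comm]
      simp only [RCLike.conj_to_real]
      field_simp
      ring
    have h2 := mul_le_mul_of_nonneg_left (hle k) (show 0 ≤ 2 / t k by positivity)
    rw [h1, h1]
    linarith
  have hlim : Tendsto (fun k => ‖(t k)⁻¹ • ((q k : EuclideanSpace ℝ (Fin n)) - x) + g‖ ^ 2 +
      2 * (r (q k) / t k - r (y k) / t k)) atTop (𝓝 0) := by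
    simpa using ((hq.add_const g).norm.pow 2).add (((hrem hqO).sub (hrem hy)).const_mul 2)
  have h1 := squeeze_zero (fun k => by positivity) hsq hlim
  have h2 : Tendsto (fun k => ‖(t k)⁻¹ • ((y k : EuclideanSpace ℝ (Fin n)) - x) + g‖) atTop
      (𝓝 0) := by
    simpa using h1.sqrt
  simpa using (tendsto_zero_iff_norm_tendsto_zero.2 h2).sub_const g

/-- Gradients of inf-convolutions converge where all the functions are differentiable. -/
theorem tendsto_gradient_infConv {u : LipSphere n} {L : ℝ≥0} (hu : LipschitzWith L u)
    {t : ℕ → ℝ} (ht : ∀ k, 0 < t k) (ht1 : ∀ k, t k ≤ 1) (ht0 : Tendsto t atTop (𝓝 0))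
    {Y : ℕ → Finset (USphere n)} (hY : ∀ k, (Y k).Nonempty)
    (hnet : ∀ k x, ∃ y ∈ Y k, dist y x ≤ t k ^ 2) {x : USphere n}
    {g : EuclideanSpace ℝ (Fin n)} (hg : HasSphericalGradientAt u g x)
    {G : ℕ → EuclideanSpace ℝ (Fin n)}
    (hG : ∀ k, HasSphericalGradientAt (u.infConv (t k) (hY k)) (G k) x) :
    Tendsto G atTop (𝓝 g) := by
  choose y hyY hy using fun k => exists_infConv_eq u (t k) (hY k) x
  -- Competitors: points of the net near a curve that leaves `x` with velocity `-∇u(x)`. The error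
  -- `t²` of the net does not change this velocity.
  obtain ⟨c, hc0, hc⟩ := exists_sphere_curve x (v := -g) (by rw [inner_neg_left, hg.1, neg_zero])
  choose q hqY hq using fun k => hnet k (c (t k))
  have hyO : (fun k => (y k : EuclideanSpace ℝ (Fin n)) - x) =O[atTop] t := by
    refine IsBigO.of_bound (2 * L + 1) (Eventually.of_forall fun k => ?_)
    rw [← dist_eq_norm, ← Subtype.dist_eq, Real.norm_eq_abs, abs_of_pos (ht k)]
    exact dist_le_of_infConv_eq hu (ht k) (ht1 k) (hnet k) (hy k)
  have hslope : Tendsto (fun k => (t k)⁻¹ • ((c (t k) : EuclideanSpace ℝ (Fin n)) - x)) atTop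
      (𝓝 (-g)) := by
    have h1 := hc.tendsto_slope_zero.comp
      (tendsto_nhdsWithin_iff.2 ⟨ht0, Eventually.of_forall fun k => (ht k).ne'⟩)
    refine h1.congr fun k => ?_
    simp [hc0]
  have hdiff : Tendsto (fun k => (t k)⁻¹ • ((q k : EuclideanSpace ℝ (Fin n)) - c (t k))) atTop
      (𝓝 0) := by
    refine squeeze_zero_norm (fun k => ?_) ht0
    rw [norm_smul, norm_inv, Real.norm_eq_abs, abs_of_pos (ht k), ← dist_eq_norm,
      ← Subtype.dist_eq, inv_mul_le_iff₀ (ht k), ← sq]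
    exact hq k
  have hqlim : Tendsto (fun k => (t k)⁻¹ • ((q k : EuclideanSpace ℝ (Fin n)) - x)) atTop
      (𝓝 (-g)) := by
    have h1 := hdiff.add hslope
    rw [zero_add] at h1
    refine h1.congr fun k => ?_
    rw [← smul_add, sub_add_sub_cancel]
  have hz := tendsto_minimizer hg ht ht0 hyO hqlim fun k => by
    have h1 := infConv_le u (t k) (hY k) (hqY k) x
    rwa [hy k, parabola_apply, parabola_apply] at h1
  have hx : Tendsto (fun _ : ℕ => (x : EuclideanSpace ℝ (Fin n))) atTop (𝓝 x) := tendsto_const_nhds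
  have hlim := (hz.sub ((hz.inner (𝕜 := ℝ) hx).smul hx)).neg
  rw [inner_neg_left, hg.1, neg_zero, zero_smul, sub_zero, neg_neg] at hlim
  exact hlim.congr fun k => (gradient_infConv (hyY k) (hy k) (hG k)).symm

theorem exists_finset_net (hn : 1 ≤ n) {ε : ℝ} (hε : 0 < ε) :
    ∃ Y : Finset (USphere n), Y.Nonempty ∧ ∀ x, ∃ y ∈ Y, dist y x ≤ ε := by
  obtain ⟨Y, -, hYf, hY⟩ := finite_cover_balls_of_compact
    (isCompact_univ (X := USphere n)) hε
  have hnet : ∀ x, ∃ y ∈ hYf.toFinset, dist y x ≤ ε := fun x => by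
    obtain ⟨y, hy, hxy⟩ := Set.mem_iUnion₂.1 (hY (Set.mem_univ x))
    exact ⟨y, hYf.mem_toFinset.2 hy, by rw [dist_comm]; exact (Metric.mem_ball.1 hxy).le⟩
  obtain ⟨y, hy, -⟩ := hnet ⟨EuclideanSpace.single ⟨0, hn⟩ 1, by simp⟩
  exact ⟨_, ⟨y, hy⟩, hnet⟩

/-- Every Lipschitz function on the sphere is a `τ`-limit of inf-convolutions. -/
theorem exists_tauTendsto_infConv (hn : 1 ≤ n) (u : LipSphere n) :
    ∃ (Y : ℕ → Finset (USphere n)) (hY : ∀ k, (Y k).Nonempty),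
      TauTendsto (fun k => u.infConv (1 / ((k : ℝ) + 1)) (hY k)) u := by
  obtain ⟨L, hL⟩ := u.lipschitz'
  set t : ℕ → ℝ := fun k => 1 / ((k : ℝ) + 1)
  have ht : ∀ k, 0 < t k := fun k => Nat.one_div_pos_of_nat
  have ht1 : ∀ k, t k ≤ 1 := fun k => by
    rw [div_le_one (by positivity)]
    exact le_add_of_nonneg_left (Nat.cast_nonneg k)
  have ht0 : Tendsto t atTop (𝓝 0) := tendsto_one_div_add_atTop_nhds_zero_nat
  choose Y hY hnet using fun k => exists_finset_net hn (pow_pos (ht k) 2)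
  refine ⟨Y, hY, ?_, ?_, 2 * L + 1, by positivity, fun k => Eventually.of_forall fun x =>
    norm_sphericalGradient_infConv_le hL (ht k) (ht1 k) (hnet k) x⟩
  · rw [Metric.tendstoUniformly_iff]
    intro ε hε
    have h1 := ht0.const_mul ((2 * (L : ℝ) + 1) * (L + 1))
    rw [mul_zero] at h1
    filter_upwards [h1.eventually_lt_const hε] with k hk x
    rw [dist_comm, Real.dist_eq]
    exact (abs_infConv_sub_le hL (ht k) (ht1 k) (hnet k) x).trans_lt hk
  · have hs : ∀ᵐ x ∂(sphereHausdorff n),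
        ∀ k, ∃ g, HasSphericalGradientAt (u.infConv (t k) (hY k)) g x := by
      refine ae_all_iff.2 fun k => ?_
      obtain ⟨M, hM⟩ := (u.infConv (t k) (hY k)).lipschitz'
      exact hM.ae_exists_hasSphericalGradientAt hn
    filter_upwards [hL.ae_exists_hasSphericalGradientAt hn, hs] with x hux hsx
    obtain ⟨g, hg⟩ := hux
    choose G hG using hsx
    rw [hg.sphericalGradient_eq]
    exact (tendsto_gradient_infConv hL ht ht1 ht0 hY hnet hg hG).congr fun k =>
      (hG k).sphericalGradient_eq.symm

theorem TauTendsto.tendsto {s : ℕ → LipSphere n} {u : LipSphere n} (h : TauTendsto s u) :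
    Tendsto s atTop (𝓝 u) :=
  tendsto_nhds.2 fun _ hU hu => hU u hu s h

/-- For small `t`, parabolas are restrictions of support functions of balls. -/
theorem eventually_parabola_mem_supportFunctions (u : LipSphere n) :
    ∀ᶠ k : ℕ in atTop, ∀ y, u.parabola (1 / ((k : ℝ) + 1)) y ∈ supportFunctions n := by
  obtain ⟨L, hL⟩ := u.lipschitz'
  obtain ⟨C, hC⟩ := (isCompact_univ (X := USphere n)).exists_bound_of_continuousOn
    hL.continuous.continuousOn
  filter_upwards [tendsto_natCast_atTop_atTop.eventually_ge_atTop C] with k hk y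
  refine affine_mem_supportFunctions ?_ _
  have h1 := neg_le_of_abs_le (hC y (Set.mem_univ y))
  rw [one_div, inv_inv]
  linarith

end LipSphere

/-! ### Valuations and support functions -/

theorem mainTheorem2 (n : ℕ) (hn : 2 ≤ n) (μ₁ μ₂ : LipSphere n → ℝ)
    (hv₁ : LipSphere.IsValuation μ₁) (hv₂ : LipSphere.IsValuation μ₂)
    (hc₁ : Continuous μ₁) (hc₂ : Continuous μ₂)
    (h : ∀ u ∈ LipSphere.supportFunctions n, μ₁ u = μ₂ u) :
    ∀ u : LipSphere n, μ₁ u = μ₂ u := by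
  intro u
  obtain ⟨Y, hY, hs⟩ := u.exists_tauTendsto_infConv (one_le_two.trans hn)
  refine tendsto_nhds_unique_of_eventuallyEq ((hc₁.tendsto u).comp hs.tendsto)
    ((hc₂.tendsto u).comp hs.tendsto) ?_
  filter_upwards [u.eventually_parabola_mem_supportFunctions] with k hk
  exact valuation_eq_finset_inf' LipSphere.supClosed_supportFunctions hv₁ hv₂ h (hY k) _
    fun y _ => hk y
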